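/- Let $n\ge 2$ and let $M$ be a smooth ($C^\infty$, Hausdorff, boundaryless) manifold of dimension $n$ with a volume form $\Omega$ (a smooth nowhere vanishing $n$-form) that is exact, $\Omega=d\alpha$ for some fixed smooth $(n-1)$-form $\alpha$. Let $X$ be a smooth vector field on $M$ that is complete, with global flow $\varphi:\mathbb{R}\times M\to M$ (the smooth action of $(\mathbb{R},+)$ on $M$, $\varphi_t=\varphi(t,\cdot)$, whose orbits $t\mapsto\varphi_t(x)$ are integral curves of $X$). Write $L_X\alpha=\frac{d}{dt}\big|_{t=0}\varphi_t^*\alpha$ for the Lie derivative. Then the following are equivalent. 1. $i_X\Omega$ is exact, i.e. $i_X\Omega=d\eta$ for some smooth $(n-2)$-form $\eta$. 2. There exists a smooth $(n-2)$-form $\beta_X$ such that $L_X\alpha=d\beta_X$. 3. There exists a smooth $(n-2)$-form $\beta$ such that for each $t\in\mathbb{R}$ the form $$\lambda_t=\int_0^t\varphi_\tau^*\beta\,d\tau$$ (the integral being taken pointwise on $M$) is a smooth $(n-2)$-form and $\varphi_t^*\alpha-\alpha=d\lambda_t$. Moreover, the forms $\beta_X$ in 2 and $\beta$ in 3 are the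 same: a smooth $(n-2)$-form $\beta$ satisfies $L_X\alpha=d\beta$ if and only if it has the property in 3. -/

import Mathlib

open scoped Manifold ContDiff

noncomputable section

namespace ExactFlow

section

variable {E : Type*} [NormedAddCommGroup E] [NormedSpace ℝ E]
  {M : Type*} [TopologicalSpace M] [ChartedSpace E M]

/-- (Rough) differential `k`-forms on a manifold `M` without boundary, modelled on `E`: at each
point an alternating `k`-linear form on the tangent space. -/
abbrev Form (E : Type*) [NormedAddCommGroup E] [NormedSpace ℝ E]
    (M : Type*) [TopologicalSpace M] [ChartedSpace E M] (k : ℕ) : Type _ :=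
  ∀ x : M, TangentSpace 𝓘(ℝ, E) x [⋀^Fin k]→L[ℝ] ℝ

/-- The coordinate expression of `θ` in the preferred chart at `x₀`, that is, the pullback of `θ`
along the inverse of this chart (meaningful on the target of the chart). -/
def Form.inChart {k : ℕ} (θ : Form E M k) (x₀ : M) (y : E) : E [⋀^Fin k]→L[ℝ] ℝ :=
  (θ ((extChartAt 𝓘(ℝ, E) x₀).symm y)).compContinuousLinearMap
    (mfderiv 𝓘(ℝ, E) 𝓘(ℝ, E) (extChartAt 𝓘(ℝ, E) x₀).symm y)

/-- A form is smooth (`C^∞`) if all its coordinate expressions are. -/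
def Form.IsSmooth {k : ℕ} (θ : Form E M k) : Prop :=
  ∀ x₀ : M, ContDiffOn ℝ ∞ (θ.inChart x₀) (extChartAt 𝓘(ℝ, E) x₀).target

/-- The pullback `f^* θ`. -/
def Form.pullback {k : ℕ} (f : M → M) (θ : Form E M k) : Form E M k := fun x =>
  (θ (f x)).compContinuousLinearMap (mfderiv 𝓘(ℝ, E) 𝓘(ℝ, E) f x)

/-- The exterior derivative `dθ`: at `x`, take the exterior derivative of the coordinate
expression in the chart around `x`, and pull it back along this chart. -/
def Form.d {k : ℕ} (θ : Form E M k) : Form E M (k + 1) := fun x =>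
  (extDeriv (θ.inChart x) (extChartAt 𝓘(ℝ, E) x x)).compContinuousLinearMap
    (mfderiv 𝓘(ℝ, E) 𝓘(ℝ, E) (extChartAt 𝓘(ℝ, E) x) x)

/-- The interior product `i_X θ = θ(X, ·, …, ·)`. -/
def Form.interior {k : ℕ} (X : ∀ x : M, TangentSpace 𝓘(ℝ, E) x) (θ : Form E M (k + 1)) :
    Form E M k := fun x =>
  ContinuousAlternatingMap.curryLeft (E := E) (θ x) (X x)

/-- A form is exact if it is the exterior derivative of a smooth form. -/
def Form.IsExact {k : ℕ} (θ : Form E M (k + 1)) : Prop :=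
  ∃ η : Form E M k, η.IsSmooth ∧ η.d = θ

/-- A volume form: a smooth, nowhere vanishing form of top degree. -/
def Form.IsVolumeForm {n : ℕ} (Ω : Form E M n) : Prop :=
  Module.finrank ℝ E = n ∧ Ω.IsSmooth ∧ ∀ x, Ω x ≠ 0

/-- `φ : ℝ × M → M` is the (smooth, global) flow generated by `X`: a smooth action of `(ℝ, +)` on
`M` all of whose orbits `t ↦ φ t x` are integral curves of `X`. In particular `X` is complete. -/
structure IsCompleteFlow (X : ∀ x : M, TangentSpace 𝓘(ℝ, E) x) (φ : ℝ → M → M) : Prop where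
  smooth : ContMDiff (𝓘(ℝ, ℝ).prod 𝓘(ℝ, E)) 𝓘(ℝ, E) ∞ (fun p : ℝ × M => φ p.1 p.2)
  map_zero : ∀ x, φ 0 x = x
  map_add : ∀ s t x, φ (s + t) x = φ s (φ t x)
  isMIntegralCurve : ∀ x, IsMIntegralCurve (I := 𝓘(ℝ, E)) (fun t => φ t x) X

/-- `η` is the Lie derivative `L_X θ` of `θ` along the vector field `X` with flow `φ`:
`η = d/dt (φ_t^* θ)` at `t = 0`, the derivative being taken in each space of alternating forms on
`T_x M`; as these are finite-dimensional, it can be tested on each tuple of tangent vectors. -/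
def Form.HasLieDeriv {k : ℕ} (φ : ℝ → M → M) (θ η : Form E M k) : Prop :=
  ∀ (x : M) (v : Fin k → TangentSpace 𝓘(ℝ, E) x),
    HasDerivAt (fun t : ℝ => θ.pullback (φ t) x v) (η x v) 0

/-- `l = ∫_0^t φ_τ^* β dτ`, the integral being taken in each space of forms on `T_x M`,
tested on each tuple of tangent vectors. -/
def Form.IsFlowIntegral {k : ℕ} (φ : ℝ → M → M) (β : Form E M k) (t : ℝ) (l : Form E M k) :
    Prop :=
  ∀ (x : M) (v : Fin k → TangentSpace 𝓘(ℝ, E) x),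
    l x v = ∫ τ in (0 : ℝ)..t, β.pullback (φ τ) x v

/-- For every `t`, the form `l = ∫_0^t φ_τ^* β dτ` is a smooth form with `φ_t^* α - α = dl`. -/
def Form.GeneratesFlow {k : ℕ} (φ : ℝ → M → M) (α : Form E M (k + 1)) (β : Form E M k) : Prop :=
  ∀ t : ℝ, ∃ l : Form E M k, l.IsSmooth ∧ Form.IsFlowIntegral φ β t l ∧ α.pullback (φ t) - α = l.d

end

end ExactFlow

end

namespace ExactFlow

open Set Filter Topology MeasureTheory

/-! Since `Ω = dα`, Cartan's formula (`IsCompleteFlow.hasLieDeriv`) reads `L_X α = i_X Ω + d(i_X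
α)`. Hence `i_X Ω` and `L_X α` are exact together, and their primitives can be chosen to differ by
`i_X α`.

For the flow condition, the group law gives `d/dt φ_t^*α = φ_t^* L_X α`
(`IsCompleteFlow.hasDerivAt_pullback`). If `L_X α = dβ`, integrating from `0` to `t` gives `φ_t^*α -
α = ∫_0^t φ_τ^* dβ dτ`. The right side is `dλ_t`, because `d` commutes with pullbacks and with the
integral (`IsCompleteFlow.isFlowIntegral_d`). Differentiating the same identity at `t = 0` gives the
converse, with the same `β`.

The analytic facts are proved for coordinate expressions and carried to `M` by the chart
independence of `d` (`Form.inChart_d`). -/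

theorem minSmoothness_real_two_le_infty : minSmoothness ℝ 2 ≤ ∞ := by
  rw [minSmoothness_of_isRCLikeNormedField]
  exact WithTop.coe_le_coe.2 (le_top (a := (2 : ℕ∞)))

/-! ### Calculus of forms on a normed space: parameter integrals and Cartan's formula. -/

section Euclidean

variable {E : Type*} [NormedAddCommGroup E] [NormedSpace ℝ E]
  {D : Type*} [NormedAddCommGroup D] [NormedSpace ℝ D]

/-- In finite dimension, an alternating map depends smoothly on parameters as soon as all its
values do. -/
theorem contDiffOn_continuousAlternatingMap_of_apply [FiniteDimensional ℝ E] {k : ℕ}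
    {r : WithTop ℕ∞} {f : D → E [⋀^Fin k]→L[ℝ] ℝ} {s : Set D}
    (h : ∀ v, ContDiffOn ℝ r (fun x => f x v) s) : ContDiffOn ℝ r f s := by
  let b := Module.finBasis ℝ E
  -- Evaluation on tuples of basis vectors is injective, so a linear left inverse recovers `f` from
  -- finitely many scalar functions.
  let Φ : (E [⋀^Fin k]→L[ℝ] ℝ) →ₗ[ℝ] ((Fin k → Fin (Module.finrank ℝ E)) → ℝ) :=
    { toFun := fun θ c => θ (fun i => b (c i))
      map_add' := fun _ _ => rfl
      map_smul' := fun _ _ => rfl }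
  have hΦ : Function.Injective Φ := by
    intro θ₁ θ₂ h12
    apply ContinuousAlternatingMap.toAlternatingMap_injective
    apply AlternatingMap.coe_multilinearMap_injective
    exact Module.Basis.ext_multilinear (fun _ => b) (fun c => congrFun h12 c)
  obtain ⟨Ψ, hΨ⟩ := LinearMap.exists_leftInverse_of_injective Φ (LinearMap.ker_eq_bot.2 hΦ)
  have hf : f = fun x => LinearMap.toContinuousLinearMap Ψ (Φ (f x)) := by
    ext1 x
    exact (LinearMap.congr_fun hΨ (f x)).symm
  rw [hf]
  exact (LinearMap.toContinuousLinearMap Ψ).contDiff.comp_contDiffOn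
    (contDiffOn_pi.2 fun c => h _)

/-- `ContinuousAlternatingMap.curryLeft` as a continuous linear map. -/
noncomputable def curryLeftCLM (E : Type*) [NormedAddCommGroup E] [NormedSpace ℝ E] (k : ℕ) :
    (E [⋀^Fin (k + 1)]→L[ℝ] ℝ) →L[ℝ] (E →L[ℝ] E [⋀^Fin k]→L[ℝ] ℝ) :=
  LinearMap.mkContinuous
    { toFun := fun f => ContinuousAlternatingMap.curryLeft (F := ℝ) f
      map_add' := fun _ _ => rfl
      map_smul' := fun _ _ => rfl } 1 fun f : E [⋀^Fin (k + 1)]→L[ℝ] ℝ => by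
    rw [one_mul]
    exact (ContinuousAlternatingMap.norm_curryLeft f).le

@[simp]
theorem curryLeftCLM_apply {k : ℕ} (f : E [⋀^Fin (k + 1)]→L[ℝ] ℝ) :
    curryLeftCLM E k f = ContinuousAlternatingMap.curryLeft f :=
  rfl

theorem contDiff_curryLeft {k : ℕ} {r : WithTop ℕ∞} :
    ContDiff ℝ r fun f : E [⋀^Fin (k + 1)]→L[ℝ] ℝ => ContinuousAlternatingMap.curryLeft f := by
  have h := ContinuousLinearMap.contDiff (𝕜 := ℝ) (n := r)
    (E := E [⋀^Fin (k + 1)]→L[ℝ] ℝ) (F := E →L[ℝ] E [⋀^Fin k]→L[ℝ] ℝ)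
    (curryLeftCLM E k)
  exact h

theorem hasFDerivAt_curryLeft {k : ℕ} (f : E [⋀^Fin (k + 1)]→L[ℝ] ℝ) :
    HasFDerivAt (fun f : E [⋀^Fin (k + 1)]→L[ℝ] ℝ => ContinuousAlternatingMap.curryLeft f)
      (curryLeftCLM E k) f :=
  ContinuousLinearMap.hasFDerivAt (F := E →L[ℝ] E [⋀^Fin k]→L[ℝ] ℝ) (curryLeftCLM E k)

/-- Currying peels off one argument at a time, which reduces the claim to evaluating continuous
linear maps. -/
theorem _root_.ContDiffAt.continuousAlternatingMap_apply {k : ℕ} {r : WithTop ℕ∞}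
    {a : D → E [⋀^Fin k]→L[ℝ] ℝ} {w : D → Fin k → E} {x : D}
    (ha : ContDiffAt ℝ r a x) (hw : ∀ i, ContDiffAt ℝ r (fun z => w z i) x) :
    ContDiffAt ℝ r (fun z => a z (w z)) x := by
  induction k with
  | zero =>
    have : (fun z => a z (w z)) =
        fun z => ContinuousAlternatingMap.apply ℝ E ℝ (fun i : Fin 0 => i.elim0) (a z) := by
      ext z
      exact congrArg (a z) (Subsingleton.elim _ _)
    rw [this]
    exact (ContinuousAlternatingMap.apply ℝ E ℝ _).contDiff.contDiffAt.comp x ha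
  | succ k ih =>
    have : (fun z => a z (w z)) = fun z =>
        (ContinuousAlternatingMap.curryLeft (a z) (w z 0)) (fun i => w z i.succ) := by
      ext z
      rw [ContinuousAlternatingMap.curryLeft_apply_apply]
      exact congrArg (a z) (Fin.cons_self_tail (w z)).symm
    rw [this]
    refine ih ?_ fun i => hw i.succ
    exact ContDiffAt.clm_apply
      (contDiff_curryLeft.contDiffAt.comp x ha) (hw 0)

theorem hasFDerivAt_comp_prodMk_right {G : Type*} [NormedAddCommGroup G] [NormedSpace ℝ G]
    {F : ℝ × E → G} {τ : ℝ} {y : E} (h : DifferentiableAt ℝ F (τ, y)) :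
    HasFDerivAt (fun z => F (τ, z))
      ((fderiv ℝ F (τ, y)).comp (ContinuousLinearMap.inr ℝ ℝ E)) y :=
  h.hasFDerivAt.comp y (hasFDerivAt_prodMk_right τ y)

theorem hasFDerivAt_intervalIntegral_of_contDiffOn [FiniteDimensional ℝ E] {F : ℝ × E → ℝ}
    {U : Set E} (hU : IsOpen U) {r : WithTop ℕ∞} (hr : 1 ≤ r)
    (hF : ContDiffOn ℝ r F (univ ×ˢ U)) (t : ℝ) {y : E} (hy : y ∈ U) :
    HasFDerivAt (fun z => ∫ τ in (0 : ℝ)..t, F (τ, z))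
      (∫ τ in (0 : ℝ)..t, fderiv ℝ (fun z => F (τ, z)) y) y := by
  have hopen : IsOpen ((univ : Set ℝ) ×ˢ U) := isOpen_univ.prod hU
  have hslice : ∀ τ : ℝ, ∀ z ∈ U, HasFDerivAt (fun z => F (τ, z))
      ((fderiv ℝ F (τ, z)).comp (ContinuousLinearMap.inr ℝ ℝ E)) z := by
    intro τ z hz
    exact hasFDerivAt_comp_prodMk_right ((hF.contDiffAt
      (hopen.mem_nhds ⟨mem_univ _, hz⟩)).differentiableAt (by rintro rfl; simp at hr))
  have hcont : ContinuousOn (fun p : ℝ × E => fderiv ℝ (fun z => F (p.1, z)) p.2)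
      (univ ×ˢ U) := by
    have h1 : ContinuousOn (fun p => (fderiv ℝ F p).comp (ContinuousLinearMap.inr ℝ ℝ E))
        (univ ×ˢ U) :=
      ((hF.continuousOn_fderiv_of_isOpen hopen hr)).clm_comp continuousOn_const
    exact h1.congr fun p hp => (hslice p.1 p.2 hp.2).fderiv
  -- The dominating function is a constant: the spatial derivative is continuous, hence bounded on
  -- the product of the time interval with a closed ball, which is compact as `E` is
  -- finite-dimensional.
  obtain ⟨ε, hε, hball⟩ := Metric.nhds_basis_closedBall.mem_iff.1 (hU.mem_nhds hy)
  have hcpt : IsCompact (uIcc 0 t ×ˢ Metric.closedBall y ε) :=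
    isCompact_uIcc.prod (isCompact_closedBall y ε)
  obtain ⟨C, hC⟩ := hcpt.exists_bound_of_continuousOn
    (hcont.mono (prod_mono (subset_univ _) hball))
  have hcs : ∀ z ∈ U, Continuous fun τ => F (τ, z) := fun z hz =>
    hF.continuousOn.comp_continuous (by fun_prop) fun τ => ⟨mem_univ _, hz⟩
  refine intervalIntegral.hasFDerivAt_integral_of_dominated_of_fderiv_le
    (F := fun z τ => F (τ, z)) (F' := fun z τ => fderiv ℝ (fun z => F (τ, z)) z)
    (bound := fun _ => C) (Metric.ball_mem_nhds y hε) ?_ ?_ ?_ ?_ ?_ ?_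
  · filter_upwards [hU.mem_nhds hy] with z hz
    exact (hcs z hz).aestronglyMeasurable
  · exact (hcs y hy).intervalIntegrable _ _
  · have : Continuous fun τ => fderiv ℝ (fun z => F (τ, z)) y :=
      hcont.comp_continuous (f := fun τ : ℝ => (τ, y)) (by fun_prop) fun τ => ⟨mem_univ _, hy⟩
    exact this.aestronglyMeasurable
  · exact ae_of_all _ fun τ hτ z hz =>
      hC (τ, z) ⟨uIoc_subset_uIcc hτ, Metric.ball_subset_closedBall hz⟩
  · exact intervalIntegrable_const
  · refine ae_of_all _ fun τ hτ z hz => ?_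
    exact (hslice τ z (hball (Metric.ball_subset_closedBall hz))).differentiableAt.hasFDerivAt

/-- The derivative is again an integral of a function of `(τ, y)` that is jointly smooth when `F`
is; this is the form that the induction in `contDiffOn_intervalIntegral` needs. -/
theorem fderiv_intervalIntegral_apply [FiniteDimensional ℝ E] {F : ℝ × E → ℝ}
    {U : Set E} (hU : IsOpen U) {r : WithTop ℕ∞} (hr : 1 ≤ r)
    (hF : ContDiffOn ℝ r F (univ ×ˢ U)) (t : ℝ) {y : E} (hy : y ∈ U) (v : E) :
    fderiv ℝ (fun z => ∫ τ in (0 : ℝ)..t, F (τ, z)) y v =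
      ∫ τ in (0 : ℝ)..t, fderiv ℝ F (τ, y) (0, v) := by
  have hopen : IsOpen ((univ : Set ℝ) ×ˢ U) := isOpen_univ.prod hU
  have hslice : ∀ τ : ℝ, fderiv ℝ (fun z => F (τ, z)) y =
      (fderiv ℝ F (τ, y)).comp (ContinuousLinearMap.inr ℝ ℝ E) := by
    intro τ
    exact (hasFDerivAt_comp_prodMk_right ((hF.contDiffAt
      (hopen.mem_nhds ⟨mem_univ _, hy⟩)).differentiableAt (by rintro rfl; simp at hr))).fderiv
  rw [(hasFDerivAt_intervalIntegral_of_contDiffOn hU hr hF t hy).fderiv]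
  simp_rw [hslice]
  have hc : Continuous fun τ : ℝ =>
      (fderiv ℝ F (τ, y)).comp (ContinuousLinearMap.inr ℝ ℝ E) := by
    refine Continuous.clm_comp ?_ continuous_const
    exact (hF.continuousOn_fderiv_of_isOpen hopen hr).comp_continuous
      (f := fun τ : ℝ => (τ, y)) (by fun_prop) fun τ => ⟨mem_univ _, hy⟩
  rw [ContinuousLinearMap.intervalIntegral_apply (hc.intervalIntegrable _ _)]
  rfl

theorem contDiffOn_intervalIntegral [FiniteDimensional ℝ E] {F : ℝ × E → ℝ}
    {U : Set E} (hU : IsOpen U) (hF : ContDiffOn ℝ ∞ F (univ ×ˢ U)) (t : ℝ) :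
    ContDiffOn ℝ ∞ (fun z => ∫ τ in (0 : ℝ)..t, F (τ, z)) U := by
  rw [contDiffOn_infty]
  intro n
  induction n generalizing F with
  | zero =>
    refine contDiffOn_zero.2 fun y hy => ?_
    exact (hasFDerivAt_intervalIntegral_of_contDiffOn hU (by simp) hF t
      hy).continuousAt.continuousWithinAt
  | succ n ih =>
    push_cast
    refine contDiffOn_succ_of_fderiv_apply (fun y hy =>
      (hasFDerivAt_intervalIntegral_of_contDiffOn hU (by simp) hF t
        hy).differentiableAt.differentiableWithinAt) (fun h => by simp at h) fun v => ?_
    have hF' : ContDiffOn ℝ ∞ (fun p => fderiv ℝ F p (0, v)) (univ ×ˢ U) :=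
      (hF.fderiv_of_isOpen (isOpen_univ.prod hU) (by simp)).clm_apply contDiffOn_const
    refine (ih hF').congr fun y hy => ?_
    rw [fderivWithin_of_isOpen hU hy, fderiv_intervalIntegral_apply hU (by simp) hF t hy v]

/-- Cartan's magic formula for the Lie derivative along `ξ`, in coordinates. -/
theorem extDeriv_add_extDeriv_curryLeft {k : ℕ} {a : E → E [⋀^Fin (k + 1)]→L[ℝ] ℝ} {ξ : E → E}
    {y : E} (ha : DifferentiableAt ℝ a y) (hξ : DifferentiableAt ℝ ξ y) (w : Fin (k + 1) → E) :
    extDeriv a y (Matrix.vecCons (ξ y) w) +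
        extDeriv (fun z => ContinuousAlternatingMap.curryLeft (a z) (ξ z)) y w =
      fderiv ℝ a y (ξ y) w + ∑ i, a y (Function.update w i (fderiv ℝ ξ y (w i))) := by
  have hc : HasFDerivAt (fun z => ContinuousAlternatingMap.curryLeft (a z))
      ((curryLeftCLM E k).comp (fderiv ℝ a y)) y :=
    HasFDerivAt.comp (f := a) (g := fun f => ContinuousAlternatingMap.curryLeft f)
      (F := E [⋀^Fin (k + 1)]→L[ℝ] ℝ) (G := E →L[ℝ] E [⋀^Fin k]→L[ℝ] ℝ) y
      (hasFDerivAt_curryLeft (a y)) ha.hasFDerivAt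
  have hi := hc.clm_apply hξ.hasFDerivAt
  -- Moving the `i`-th argument to the front costs the sign `(-1) ^ i`, the sign with which this
  -- term occurs in the exterior derivative.
  have key : ∀ i : Fin (k + 1), ∀ z : E, a y (Function.update w i z) =
      (-1) ^ (i : ℕ) • a y (Matrix.vecCons z (i.removeNth w)) := by
    intro i z
    rw [← Fin.insertNth_removeNth]
    exact (a y).toAlternatingMap.map_insertNth i z _
  simp only [extDeriv, hi.fderiv, ContinuousAlternatingMap.alternatizeUncurryFin_apply,
    Fin.sum_univ_succ (n := k + 1), key]
  have h0 : (0 : Fin (k + 2)).removeNth (Matrix.vecCons (ξ y) w : Fin (k + 2) → E) = w := by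
    ext i; simp [Fin.removeNth]
  have hs : ∀ i : Fin (k + 1), i.succ.removeNth (Matrix.vecCons (ξ y) w : Fin (k + 2) → E) =
      (Matrix.vecCons (ξ y) (i.removeNth w) : Fin (k + 1) → E) := by
    intro i
    ext j
    refine Fin.cases ?_ (fun j => ?_) j <;> simp [Fin.removeNth]
  simp only [h0, hs]
  -- Paired index by index, the terms differentiating `a` along `w i` have opposite signs and
  -- cancel; those containing the derivative of `ξ` remain.
  rw [add_assoc, ← Finset.sum_add_distrib]
  simp [pow_succ]

/-- The derivative at `t = 0` of the pullback of `a` along `G (t, ·)`, where `G (0, ·)` is the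
identity near `y`. -/
theorem hasDerivAt_comp_fderiv_of_eventually_eq_id {k : ℕ}
    {a : E → E [⋀^Fin (k + 1)]→L[ℝ] ℝ} {G : ℝ × E → E} {y : E} (ha : DifferentiableAt ℝ a y)
    (hG : ContDiffAt ℝ ∞ G (0, y)) (hG₀ : ∀ᶠ z in 𝓝 y, G (0, z) = z) (w : Fin (k + 1) → E) :
    HasDerivAt (fun t => (a (G (t, y))).compContinuousLinearMap
        ((fderiv ℝ G (t, y)).comp (ContinuousLinearMap.inr ℝ ℝ E)) w)
      (extDeriv a y (Matrix.vecCons (fderiv ℝ G (0, y) (1, 0)) w) +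
        extDeriv (fun z => ContinuousAlternatingMap.curryLeft (a z)
          (fderiv ℝ G (0, z) (1, 0))) y w) 0 := by
  have hGy : G (0, y) = y := hG₀.self_of_nhds
  have hGd : DifferentiableAt ℝ G (0, y) := hG.differentiableAt (by simp)
  have hG2 : HasFDerivAt (fderiv ℝ G) (fderiv ℝ (fderiv ℝ G) (0, y)) (0, y) :=
    ((hG.fderiv_right (m := ∞) (by simp)).differentiableAt (by simp)).hasFDerivAt
  -- Symmetry of second derivatives identifies the time derivative of the spatial differential of
  -- `G` with the spatial differential of the velocity `ξ`.
  have hsymm : IsSymmSndFDerivAt ℝ G (0, y) := hG.isSymmSndFDerivAt minSmoothness_real_two_le_infty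
  have hid : (fderiv ℝ G (0, y)).comp (ContinuousLinearMap.inr ℝ ℝ E) =
      ContinuousLinearMap.id ℝ E := by
    rw [← (hasFDerivAt_comp_prodMk_right hGd).fderiv,
      Filter.EventuallyEq.fderiv_eq (f := fun z => z) hG₀]
    exact fderiv_fun_id
  have hξ : HasFDerivAt (fun z => fderiv ℝ G (0, z) (1, 0))
      (((ContinuousLinearMap.apply ℝ E ((1, 0) : ℝ × E)).comp
        (fderiv ℝ (fderiv ℝ G) (0, y))).comp (ContinuousLinearMap.inr ℝ ℝ E)) y :=
    ((ContinuousLinearMap.apply ℝ E ((1, 0) : ℝ × E)).hasFDerivAt.comp (0, y) hG2).comp y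
      (hasFDerivAt_prodMk_right 0 y)
  have h1 : HasFDerivAt (fun t => G (t, y))
      ((fderiv ℝ G (0, y)).comp (ContinuousLinearMap.inl ℝ ℝ E)) 0 :=
    hGd.hasFDerivAt.comp (0 : ℝ) (hasFDerivAt_prodMk_left 0 y)
  have h2 : HasFDerivAt (fun t => a (G (t, y))) ((fderiv ℝ a y).comp
      ((fderiv ℝ G (0, y)).comp (ContinuousLinearMap.inl ℝ ℝ E))) 0 := by
    refine HasFDerivAt.comp (0 : ℝ) ?_ h1
    rw [hGy]
    exact ha.hasFDerivAt
  have h3 : HasFDerivAt (fun t => (fderiv ℝ G (t, y)).comp (ContinuousLinearMap.inr ℝ ℝ E))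
      (((ContinuousLinearMap.compL ℝ E (ℝ × E) E).flip (ContinuousLinearMap.inr ℝ ℝ E)).comp
        ((fderiv ℝ (fderiv ℝ G) (0, y)).comp (ContinuousLinearMap.inl ℝ ℝ E))) 0 :=
    ((ContinuousLinearMap.compL ℝ E (ℝ × E) E).flip
      (ContinuousLinearMap.inr ℝ ℝ E)).hasFDerivAt.comp (0 : ℝ)
        (hG2.comp (0 : ℝ) (hasFDerivAt_prodMk_left 0 y))
  have h4 := ((ContinuousAlternatingMap.apply ℝ E ℝ w).hasFDerivAt.comp (0 : ℝ)
    (h2.continuousAlternatingMapCompContinuousLinearMap h3)).hasDerivAt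
  refine h4.congr_deriv ?_
  rw [extDeriv_add_extDeriv_curryLeft ha hξ.differentiableAt, hξ.fderiv]
  simp only [hid, hGy, ContinuousLinearMap.comp_apply, add_apply,
    ContinuousAlternatingMap.apply_apply, ContinuousAlternatingMap.add_apply,
    ContinuousAlternatingMap.fderivCompContinuousLinearMap_apply]
  congr 1
  refine Finset.sum_congr rfl fun i _ => congrArg (a y) (funext fun j => ?_)
  rcases eq_or_ne j i with rfl | hij
  · simpa using hsymm (1, 0) (0, w j)
  · simp [hij]

end Euclidean

/-! ### Forms on manifolds: pullback and exterior derivative in charts. -/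

section Manifold

variable {E : Type*} [NormedAddCommGroup E] [NormedSpace ℝ E]
  {M : Type*} [TopologicalSpace M] [ChartedSpace E M]

/-- The tangent spaces at `p` and `q` are distinct types, both definitionally `E`. Typing the
vectors in `E` makes it possible to transport along `p = q` without casts. -/
theorem Form.apply_congr {k : ℕ} (θ : Form E M k) {p q : M} (h : p = q) {v w : Fin k → E}
    (hvw : v = w) :
    (θ p : E [⋀^Fin k]→L[ℝ] ℝ) v = (θ q : E [⋀^Fin k]→L[ℝ] ℝ) w := by
  subst h hvw
  rfl

theorem Form.pullback_id {k : ℕ} (θ : Form E M k) : θ.pullback (fun x => x) = θ := by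
  funext x
  ext v
  change θ x (fun i => mfderiv 𝓘(ℝ, E) 𝓘(ℝ, E) (fun x : M => x) x (v i)) = _
  have : mfderiv 𝓘(ℝ, E) 𝓘(ℝ, E) (fun x : M => x) x = ContinuousLinearMap.id ℝ _ := mfderiv_id
  rw [this]
  rfl

theorem Form.IsSmooth.contDiffAt {k : ℕ} {θ : Form E M k} (hθ : θ.IsSmooth) {x₀ : M} {y : E}
    (hy : y ∈ (extChartAt 𝓘(ℝ, E) x₀).target) : ContDiffAt ℝ ∞ (θ.inChart x₀) y :=
  (hθ x₀).contDiffAt ((isOpen_extChartAt_target x₀).mem_nhds hy)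

theorem Form.IsSmooth.add {k : ℕ} {θ η : Form E M k} (hθ : θ.IsSmooth) (hη : η.IsSmooth) :
    (θ + η).IsSmooth := fun x₀ => (hθ x₀).add (hη x₀)

theorem Form.IsSmooth.sub {k : ℕ} {θ η : Form E M k} (hθ : θ.IsSmooth) (hη : η.IsSmooth) :
    (θ - η).IsSmooth := fun x₀ => (hθ x₀).sub (hη x₀)

variable [IsManifold 𝓘(ℝ, E) ∞ M]

theorem mdifferentiableAt_extChartAt_symm {x : M} {y : E}
    (hy : y ∈ (extChartAt 𝓘(ℝ, E) x).target) :
    MDifferentiableAt 𝓘(ℝ, E) 𝓘(ℝ, E) (extChartAt 𝓘(ℝ, E) x).symm y :=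
  ((contMDiffOn_extChartAt_symm (n := ∞) x).contMDiffAt
    ((isOpen_extChartAt_target x).mem_nhds hy)).mdifferentiableAt (by simp)

theorem Form.inChart_pullback {k : ℕ} (θ : Form E M k) {f : M → M} {x₀ x₁ : M} {y : E}
    (hy : y ∈ (extChartAt 𝓘(ℝ, E) x₀).target)
    (hf : MDifferentiableAt 𝓘(ℝ, E) 𝓘(ℝ, E) f ((extChartAt 𝓘(ℝ, E) x₀).symm y))
    (hfy : f ((extChartAt 𝓘(ℝ, E) x₀).symm y) ∈ (extChartAt 𝓘(ℝ, E) x₁).source) :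
    (θ.pullback f).inChart x₀ y =
      (θ.inChart x₁ (extChartAt 𝓘(ℝ, E) x₁
        (f ((extChartAt 𝓘(ℝ, E) x₀).symm y)))).compContinuousLinearMap
        (fderiv ℝ (fun z => extChartAt 𝓘(ℝ, E) x₁ (f ((extChartAt 𝓘(ℝ, E) x₀).symm z))) y) := by
  have : IsManifold 𝓘(ℝ, E) 1 M := .of_le (n := ∞) (by simp)
  set e₀ := extChartAt 𝓘(ℝ, E) x₀
  set e₁ := extChartAt 𝓘(ℝ, E) x₁
  set g : E → E := fun z => e₁ (f (e₀.symm z)) with hg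
  have hs : MDifferentiableAt 𝓘(ℝ, E) 𝓘(ℝ, E) e₀.symm y := mdifferentiableAt_extChartAt_symm hy
  have h1 : HasMFDerivAt 𝓘(ℝ, E) 𝓘(ℝ, E) (f ∘ e₀.symm) y
      ((mfderiv 𝓘(ℝ, E) 𝓘(ℝ, E) f (e₀.symm y)).comp (mfderiv 𝓘(ℝ, E) 𝓘(ℝ, E) e₀.symm y)) :=
    hf.hasMFDerivAt.comp y hs.hasMFDerivAt
  have he₁ : MDifferentiableAt 𝓘(ℝ, E) 𝓘(ℝ, E) e₁ (f (e₀.symm y)) :=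
    mdifferentiableAt_extChartAt (by rwa [extChartAt_source] at hfy)
  have hgd : MDifferentiableAt 𝓘(ℝ, E) 𝓘(ℝ, E) g y :=
    MDifferentiableAt.comp y he₁ h1.mdifferentiableAt
  have hs₁ : MDifferentiableAt 𝓘(ℝ, E) 𝓘(ℝ, E) e₁.symm (g y) :=
    mdifferentiableAt_extChartAt_symm (e₁.map_source hfy)
  have h2 : HasMFDerivAt 𝓘(ℝ, E) 𝓘(ℝ, E) (e₁.symm ∘ g) y
      ((mfderiv 𝓘(ℝ, E) 𝓘(ℝ, E) e₁.symm (g y)).comp (mfderiv 𝓘(ℝ, E) 𝓘(ℝ, E) g y)) :=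
    hs₁.hasMFDerivAt.comp y hgd.hasMFDerivAt
  -- Two factorizations of the same germ: the chain rule for each, with uniqueness of the
  -- derivative, gives the identity of differentials.
  have hev : f ∘ e₀.symm =ᶠ[𝓝 y] e₁.symm ∘ g := by
    have : e₁.source ∈ 𝓝 (f (e₀.symm y)) :=
      (isOpen_extChartAt_source x₁).mem_nhds hfy
    filter_upwards [h1.continuousAt.preimage_mem_nhds this] with z hz
    exact (e₁.left_inv hz).symm
  have h3 := hasMFDerivAt_unique h1 (h2.congr_of_eventuallyEq hev)
  rw [mfderiv_eq_fderiv] at h3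
  ext v
  refine θ.apply_congr (e₁.left_inv hfy).symm (funext fun i => ?_)
  exact congrArg (fun L : E →L[ℝ] E => L (v i)) h3

theorem Form.apply_eq_inChart {k : ℕ} (θ : Form E M k) (x : M)
    (v : Fin k → TangentSpace 𝓘(ℝ, E) x) :
    θ x v = θ.inChart x (extChartAt 𝓘(ℝ, E) x x)
      (fun i => mfderiv 𝓘(ℝ, E) 𝓘(ℝ, E) (extChartAt 𝓘(ℝ, E) x) x (v i)) := by
  have : IsManifold 𝓘(ℝ, E) 1 M := .of_le (n := ∞) (by simp)
  have hinv := mfderivWithin_extChartAt_symm_comp_mfderiv_extChartAt'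
    (I := 𝓘(ℝ, E)) (mem_extChartAt_source (I := 𝓘(ℝ, E)) x)
  rw [modelWithCornersSelf_coe, range_id, mfderivWithin_univ] at hinv
  refine θ.apply_congr (extChartAt_to_inv x).symm (funext fun i => ?_)
  exact (congrArg (fun L : E →L[ℝ] E => L (v i)) hinv).symm

/-- Forms with the same coordinate expressions are equal. -/
theorem Form.ext_inChart {k : ℕ} {θ η : Form E M k}
    (h : ∀ x₀, ∀ y ∈ (extChartAt 𝓘(ℝ, E) x₀).target, θ.inChart x₀ y = η.inChart x₀ y) :
    θ = η := by
  funext x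
  ext v
  rw [θ.apply_eq_inChart, η.apply_eq_inChart, h x _ (mem_extChartAt_target x)]

theorem contDiffAt_inChart_map {f : M → M} (hf : ContMDiff 𝓘(ℝ, E) 𝓘(ℝ, E) ∞ f) {x₀ x₁ : M}
    {y : E} (hy : y ∈ (extChartAt 𝓘(ℝ, E) x₀).target)
    (hfy : f ((extChartAt 𝓘(ℝ, E) x₀).symm y) ∈ (extChartAt 𝓘(ℝ, E) x₁).source) :
    ContDiffAt ℝ ∞
      (fun z => extChartAt 𝓘(ℝ, E) x₁ (f ((extChartAt 𝓘(ℝ, E) x₀).symm z))) y := by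
  rw [← contMDiffAt_iff_contDiffAt]
  have h1 := (contMDiffOn_extChartAt_symm (n := ∞) (I := 𝓘(ℝ, E)) x₀).contMDiffAt
    ((isOpen_extChartAt_target x₀).mem_nhds hy)
  have h2 : ContMDiffAt 𝓘(ℝ, E) 𝓘(ℝ, E) ∞ (extChartAt 𝓘(ℝ, E) x₁)
      (f ((extChartAt 𝓘(ℝ, E) x₀).symm y)) :=
    contMDiffAt_extChartAt' (by rwa [extChartAt_source] at hfy)
  exact h2.comp y (hf.contMDiffAt.comp y h1)

/-- In coordinates, the exterior derivative of a pullback is the pullback of the exterior derivative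
of the coordinate expression. -/
theorem Form.extDeriv_inChart_pullback {k : ℕ} {θ : Form E M k} (hθ : θ.IsSmooth) {f : M → M}
    (hf : ContMDiff 𝓘(ℝ, E) 𝓘(ℝ, E) ∞ f) {x₀ x₁ : M} {y : E}
    (hy : y ∈ (extChartAt 𝓘(ℝ, E) x₀).target)
    (hfy : f ((extChartAt 𝓘(ℝ, E) x₀).symm y) ∈ (extChartAt 𝓘(ℝ, E) x₁).source) :
    extDeriv ((θ.pullback f).inChart x₀) y =
      (extDeriv (θ.inChart x₁) (extChartAt 𝓘(ℝ, E) x₁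
        (f ((extChartAt 𝓘(ℝ, E) x₀).symm y)))).compContinuousLinearMap
        (fderiv ℝ (fun z => extChartAt 𝓘(ℝ, E) x₁ (f ((extChartAt 𝓘(ℝ, E) x₀).symm z))) y) := by
  have hev : (θ.pullback f).inChart x₀ =ᶠ[𝓝 y] fun z =>
      (θ.inChart x₁ (extChartAt 𝓘(ℝ, E) x₁
        (f ((extChartAt 𝓘(ℝ, E) x₀).symm z)))).compContinuousLinearMap
        (fderiv ℝ (fun z => extChartAt 𝓘(ℝ, E) x₁ (f ((extChartAt 𝓘(ℝ, E) x₀).symm z))) z) := by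
    have hc : ContinuousAt (fun z => f ((extChartAt 𝓘(ℝ, E) x₀).symm z)) y :=
      hf.continuous.continuousAt.comp (mdifferentiableAt_extChartAt_symm hy).continuousAt
    filter_upwards [(isOpen_extChartAt_target x₀).mem_nhds hy,
      hc.preimage_mem_nhds ((isOpen_extChartAt_source x₁).mem_nhds hfy)] with z hz hfz
    exact θ.inChart_pullback hz (hf.mdifferentiable (by simp) _) hfz
  rw [hev.extDeriv_eq]
  exact extDeriv_pullback (r := ∞)
    ((hθ.contDiffAt ((extChartAt 𝓘(ℝ, E) x₁).map_source hfy)).differentiableAt (by simp))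
    (contDiffAt_inChart_map hf hy hfy) minSmoothness_real_two_le_infty

/-- `Form.d` uses a different chart at each point, so this is chart independence. It follows from
naturality applied to the identity map, read between the chart at `x₀` and the chart at the point in
question. -/
theorem Form.inChart_d {k : ℕ} {θ : Form E M k} (hθ : θ.IsSmooth) {x₀ : M} {y : E}
    (hy : y ∈ (extChartAt 𝓘(ℝ, E) x₀).target) :
    θ.d.inChart x₀ y = extDeriv (θ.inChart x₀) y := by
  have : IsManifold 𝓘(ℝ, E) 1 M := .of_le (n := ∞) (by simp)
  have h := Form.extDeriv_inChart_pullback hθ (contMDiff_id (n := ∞)) hy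
    (mem_extChartAt_source (I := 𝓘(ℝ, E)) ((extChartAt 𝓘(ℝ, E) x₀).symm y))
  have hid : θ.pullback id = θ := θ.pullback_id
  rw [hid] at h
  rw [h]
  have hd : HasMFDerivAt 𝓘(ℝ, E) 𝓘(ℝ, E)
      (extChartAt 𝓘(ℝ, E) ((extChartAt 𝓘(ℝ, E) x₀).symm y) ∘ (extChartAt 𝓘(ℝ, E) x₀).symm) y _ :=
    HasMFDerivAt.comp y (mdifferentiableAt_extChartAt (mem_chart_source E _)).hasMFDerivAt
      (mdifferentiableAt_extChartAt_symm hy).hasMFDerivAt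
  have hd' := hd.mfderiv
  rw [mfderiv_eq_fderiv] at hd'
  ext v
  refine congrArg (extDeriv (θ.inChart ((extChartAt 𝓘(ℝ, E) x₀).symm y))
    (extChartAt 𝓘(ℝ, E) _ ((extChartAt 𝓘(ℝ, E) x₀).symm y))) (funext fun i => ?_)
  exact (congrArg (fun L : E →L[ℝ] E => L (v i)) hd').symm

theorem Form.d_pullback {k : ℕ} {θ : Form E M k} (hθ : θ.IsSmooth) {f : M → M}
    (hf : ContMDiff 𝓘(ℝ, E) 𝓘(ℝ, E) ∞ f) (hfθ : (θ.pullback f).IsSmooth) :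
    (θ.pullback f).d = θ.d.pullback f := by
  refine Form.ext_inChart fun x₀ y hy => ?_
  have hfy := mem_extChartAt_source (I := 𝓘(ℝ, E)) (f ((extChartAt 𝓘(ℝ, E) x₀).symm y))
  rw [Form.inChart_d hfθ hy, Form.extDeriv_inChart_pullback hθ hf hy hfy,
    Form.inChart_pullback _ hy (hf.mdifferentiable (by simp) _) hfy,
    Form.inChart_d hθ (PartialEquiv.map_source _ hfy)]

theorem Form.d_add {k : ℕ} {θ η : Form E M k} (hθ : θ.IsSmooth) (hη : η.IsSmooth) :
    (θ + η).d = θ.d + η.d := by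
  refine Form.ext_inChart fun x₀ y hy => ?_
  rw [Form.inChart_d (hθ.add hη) hy]
  have h : (θ.d + η.d).inChart x₀ y = θ.d.inChart x₀ y + η.d.inChart x₀ y := rfl
  rw [h, Form.inChart_d hθ hy, Form.inChart_d hη hy]
  exact extDeriv_add ((hθ.contDiffAt hy).differentiableAt (by simp))
    ((hη.contDiffAt hy).differentiableAt (by simp))

theorem Form.IsSmooth.d [FiniteDimensional ℝ E] {k : ℕ} {θ : Form E M k} (hθ : θ.IsSmooth) :
    θ.d.IsSmooth := by
  intro x₀
  refine ContDiffOn.congr ?_ fun y hy => Form.inChart_d hθ hy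
  refine contDiffOn_continuousAlternatingMap_of_apply fun v => ?_
  simp only [extDeriv, ContinuousAlternatingMap.alternatizeUncurryFin_apply]
  refine ContDiffOn.sum fun i _ => ContDiffOn.const_smul _ ?_
  exact (ContinuousAlternatingMap.apply ℝ E ℝ _).contDiff.comp_contDiffOn
    (((hθ x₀).fderiv_of_isOpen (m := ∞) (isOpen_extChartAt_target x₀) (by simp)).clm_apply
      contDiffOn_const)

end Manifold

/-! ### Pullback, integration and Lie derivative along the flow. -/

section Flow

variable {E : Type*} [NormedAddCommGroup E] [NormedSpace ℝ E]
  {M : Type*} [TopologicalSpace M] [ChartedSpace E M]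
  {X : ∀ x : M, TangentSpace 𝓘(ℝ, E) x} {φ : ℝ → M → M}

theorem IsCompleteFlow.contMDiff (hφ : IsCompleteFlow X φ) (t : ℝ) :
    ContMDiff 𝓘(ℝ, E) 𝓘(ℝ, E) ∞ (φ t) :=
  hφ.smooth.comp (contMDiff_const.prodMk contMDiff_id)

theorem IsCompleteFlow.pullback_zero (hφ : IsCompleteFlow X φ) {k : ℕ} (θ : Form E M k) :
    θ.pullback (φ 0) = θ := by
  rw [show φ 0 = fun x => x from funext hφ.map_zero, θ.pullback_id]

theorem IsCompleteFlow.pullback_add_apply (hφ : IsCompleteFlow X φ) {k : ℕ} (θ : Form E M k)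
    (s t : ℝ) (x : M) (v : Fin k → TangentSpace 𝓘(ℝ, E) x) :
    θ.pullback (φ (s + t)) x v =
      θ.pullback (φ s) (φ t x) (fun i => mfderiv 𝓘(ℝ, E) 𝓘(ℝ, E) (φ t) x (v i)) := by
  have hd : mfderiv 𝓘(ℝ, E) 𝓘(ℝ, E) (φ (s + t)) x =
      (mfderiv 𝓘(ℝ, E) 𝓘(ℝ, E) (φ s) (φ t x)).comp (mfderiv 𝓘(ℝ, E) 𝓘(ℝ, E) (φ t) x) := by
    rw [show φ (s + t) = φ s ∘ φ t from funext (hφ.map_add s t)]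
    exact mfderiv_comp x ((hφ.contMDiff s).mdifferentiable (by simp) _)
      ((hφ.contMDiff t).mdifferentiable (by simp) _)
  exact θ.apply_congr (hφ.map_add s t x)
    (funext fun i => congrArg (fun L : E →L[ℝ] E => L (v i)) hd)

theorem Form.HasLieDeriv.unique {k : ℕ} {θ η₁ η₂ : Form E M k} (h₁ : θ.HasLieDeriv φ η₁)
    (h₂ : θ.HasLieDeriv φ η₂) : η₁ = η₂ := by
  funext x
  ext v
  exact (h₁ x v).unique (h₂ x v)

/-- Writing `φ t = φ (t - s) ∘ φ s` moves the derivative at time `s` to time `0` at the point `φ s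
x`, where the Lie derivative is defined. -/
theorem IsCompleteFlow.hasDerivAt_pullback (hφ : IsCompleteFlow X φ) {k : ℕ} {θ η : Form E M k}
    (h : θ.HasLieDeriv φ η) (s : ℝ) (x : M) (v : Fin k → TangentSpace 𝓘(ℝ, E) x) :
    HasDerivAt (fun t => θ.pullback (φ t) x v) (η.pullback (φ s) x v) s := by
  have h0 := h (φ s x) fun i => mfderiv 𝓘(ℝ, E) 𝓘(ℝ, E) (φ s) x (v i)
  rw [← sub_self s] at h0
  refine (h0.comp_sub_const s s).congr_of_eventuallyEq (Eventually.of_forall fun t => ?_)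
  beta_reduce
  rw [← hφ.pullback_add_apply, sub_add_cancel]

variable [IsManifold 𝓘(ℝ, E) ∞ M]

theorem IsCompleteFlow.contDiffAt_inChart (hφ : IsCompleteFlow X φ) {x₀ x₁ : M} {τ : ℝ} {y : E}
    (hy : y ∈ (extChartAt 𝓘(ℝ, E) x₀).target)
    (hφy : φ τ ((extChartAt 𝓘(ℝ, E) x₀).symm y) ∈ (extChartAt 𝓘(ℝ, E) x₁).source) :
    ContDiffAt ℝ ∞ (fun p : ℝ × E =>
      extChartAt 𝓘(ℝ, E) x₁ (φ p.1 ((extChartAt 𝓘(ℝ, E) x₀).symm p.2))) (τ, y) := by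
  rw [← contMDiffAt_iff_contDiffAt]
  have h1 : ContMDiffAt 𝓘(ℝ, ℝ × E) 𝓘(ℝ, E) ∞
      (fun p : ℝ × E => (extChartAt 𝓘(ℝ, E) x₀).symm p.2) (τ, y) :=
    ContMDiffAt.comp (τ, y) ((contMDiffOn_extChartAt_symm (n := ∞) (I := 𝓘(ℝ, E)) x₀).contMDiffAt
      ((isOpen_extChartAt_target x₀).mem_nhds hy)) contDiff_snd.contMDiff.contMDiffAt
  have h2 : ContMDiffAt 𝓘(ℝ, ℝ × E) 𝓘(ℝ, ℝ) ∞ (fun p : ℝ × E => p.1) (τ, y) :=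
    contDiff_fst.contMDiff.contMDiffAt
  have h3 : ContMDiffAt 𝓘(ℝ, E) 𝓘(ℝ, E) ∞ (extChartAt 𝓘(ℝ, E) x₁)
      (φ τ ((extChartAt 𝓘(ℝ, E) x₀).symm y)) :=
    contMDiffAt_extChartAt' (by rwa [extChartAt_source] at hφy)
  exact ContMDiffAt.comp (τ, y) h3
    (ContMDiffAt.comp (τ, y) (hφ.smooth.contMDiffAt) (h2.prodMk h1))

/-- Near a point whose image lies in the chart at `x₁`, the pullback along the flow is read in
coordinates. -/
theorem IsCompleteFlow.eventually_inChart_pullback (hφ : IsCompleteFlow X φ) {k : ℕ}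
    (θ : Form E M k) {x₀ x₁ : M} {τ : ℝ} {y : E}
    (hy : y ∈ (extChartAt 𝓘(ℝ, E) x₀).target)
    (hφy : φ τ ((extChartAt 𝓘(ℝ, E) x₀).symm y) ∈ (extChartAt 𝓘(ℝ, E) x₁).source) :
    ∀ᶠ p : ℝ × E in 𝓝 (τ, y), (θ.pullback (φ p.1)).inChart x₀ p.2 =
      (θ.inChart x₁ (extChartAt 𝓘(ℝ, E) x₁
        (φ p.1 ((extChartAt 𝓘(ℝ, E) x₀).symm p.2)))).compContinuousLinearMap
      ((fderiv ℝ (fun p : ℝ × E =>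
        extChartAt 𝓘(ℝ, E) x₁ (φ p.1 ((extChartAt 𝓘(ℝ, E) x₀).symm p.2))) p).comp
        (ContinuousLinearMap.inr ℝ ℝ E)) := by
  have hc : ContinuousAt (fun p : ℝ × E => φ p.1 ((extChartAt 𝓘(ℝ, E) x₀).symm p.2)) (τ, y) := by
    have h1 : ContinuousAt (fun p : ℝ × E => (p.1, (extChartAt 𝓘(ℝ, E) x₀).symm p.2)) (τ, y) :=
      continuousAt_fst.prodMk (ContinuousAt.comp (x := ((τ, y) : ℝ × E))
        (mdifferentiableAt_extChartAt_symm hy).continuousAt continuousAt_snd)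
    exact ContinuousAt.comp (x := ((τ, y) : ℝ × E)) hφ.smooth.continuous.continuousAt h1
  filter_upwards [continuousAt_snd.preimage_mem_nhds ((isOpen_extChartAt_target x₀).mem_nhds hy),
    hc.preimage_mem_nhds ((isOpen_extChartAt_source x₁).mem_nhds hφy)] with p hp hφp
  rw [θ.inChart_pullback hp ((hφ.contMDiff p.1).mdifferentiable (by simp) _) hφp]
  congr 1
  exact (hasFDerivAt_comp_prodMk_right
    ((hφ.contDiffAt_inChart hp hφp).differentiableAt (by simp))).fderiv

theorem IsCompleteFlow.contDiffOn_inChart_pullback (hφ : IsCompleteFlow X φ) {k : ℕ}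
    {θ : Form E M k} (hθ : θ.IsSmooth) (x₀ : M) (w : Fin k → E) :
    ContDiffOn ℝ ∞ (fun p : ℝ × E => (θ.pullback (φ p.1)).inChart x₀ p.2 w)
      (univ ×ˢ (extChartAt 𝓘(ℝ, E) x₀).target) := by
  rintro ⟨τ, y⟩ ⟨-, hy⟩
  refine ContDiffAt.contDiffWithinAt ?_
  have hφy := mem_extChartAt_source (I := 𝓘(ℝ, E)) (φ τ ((extChartAt 𝓘(ℝ, E) x₀).symm y))
  have hG := hφ.contDiffAt_inChart hy hφy
  refine ContDiffAt.congr_of_eventuallyEq ?_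
    ((hφ.eventually_inChart_pullback θ hy hφy).mono fun p hp =>
      congrArg (fun a : E [⋀^Fin k]→L[ℝ] ℝ => a w) hp)
  have ha := ContDiffAt.comp ((τ, y) : ℝ × E)
    (hθ.contDiffAt (PartialEquiv.map_source _ hφy)) hG
  exact ha.continuousAlternatingMap_apply fun i =>
    (hG.fderiv_right (m := ∞) (by simp)).clm_apply contDiffAt_const

theorem IsCompleteFlow.isSmooth_pullback [FiniteDimensional ℝ E] (hφ : IsCompleteFlow X φ) {k : ℕ}
    {θ : Form E M k} (hθ : θ.IsSmooth) (t : ℝ) : (θ.pullback (φ t)).IsSmooth := fun x₀ =>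
  contDiffOn_continuousAlternatingMap_of_apply fun w =>
    (hφ.contDiffOn_inChart_pullback hθ x₀ w).comp
      (contDiff_const.prodMk contDiff_id).contDiffOn fun _ hz => ⟨mem_univ _, hz⟩

theorem IsCompleteFlow.continuous_pullback_apply (hφ : IsCompleteFlow X φ) {k : ℕ}
    {θ : Form E M k} (hθ : θ.IsSmooth) (x : M) (v : Fin k → TangentSpace 𝓘(ℝ, E) x) :
    Continuous fun t => θ.pullback (φ t) x v := by
  simp_rw [Form.apply_eq_inChart _ x v]
  exact (hφ.contDiffOn_inChart_pullback hθ x _).continuousOn.comp_continuous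
    (f := fun t : ℝ => (t, extChartAt 𝓘(ℝ, E) x x)) (by fun_prop)
    fun t => ⟨mem_univ _, mem_extChartAt_target x⟩

/-- The integral is taken in the space of alternating maps itself; evaluation on a tuple is
continuous and linear, so it commutes with the integral. -/
theorem IsCompleteFlow.exists_isFlowIntegral [FiniteDimensional ℝ E] (hφ : IsCompleteFlow X φ)
    {k : ℕ} {β : Form E M k} (hβ : β.IsSmooth) (t : ℝ) :
    ∃ l : Form E M k, Form.IsFlowIntegral φ β t l := by
  refine ⟨fun x => (∫ τ in (0 : ℝ)..t, β.pullback (φ τ) x : E [⋀^Fin k]→L[ℝ] ℝ), fun x v => ?_⟩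
  have hc : Continuous fun τ => (β.pullback (φ τ) x : E [⋀^Fin k]→L[ℝ] ℝ) :=
    continuousOn_univ.1 (contDiffOn_continuousAlternatingMap_of_apply (E := E) (r := 0) fun v =>
      contDiffOn_zero.2 (hφ.continuous_pullback_apply hβ x v).continuousOn).continuousOn
  exact ((ContinuousAlternatingMap.apply ℝ E ℝ v).intervalIntegral_comp_comm
    (hc.intervalIntegrable 0 t)).symm

theorem IsCompleteFlow.isSmooth_of_isFlowIntegral [FiniteDimensional ℝ E]
    (hφ : IsCompleteFlow X φ) {k : ℕ} {β l : Form E M k} (hβ : β.IsSmooth) {t : ℝ}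
    (hl : Form.IsFlowIntegral φ β t l) : l.IsSmooth := fun x₀ =>
  contDiffOn_continuousAlternatingMap_of_apply fun w =>
    (contDiffOn_intervalIntegral (isOpen_extChartAt_target x₀)
      (hφ.contDiffOn_inChart_pullback hβ x₀ w) t).congr fun _ _ => hl _ _

theorem IsCompleteFlow.inChart_d_of_isFlowIntegral [FiniteDimensional ℝ E]
    (hφ : IsCompleteFlow X φ) {k : ℕ} {β l : Form E M k} (hβ : β.IsSmooth) {t : ℝ}
    (hl : Form.IsFlowIntegral φ β t l) {x : M} {y : E}
    (hy : y ∈ (extChartAt 𝓘(ℝ, E) x).target) (v : Fin (k + 1) → E) :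
    l.d.inChart x y v = ∫ τ in (0 : ℝ)..t, (β.d.pullback (φ τ)).inChart x y v := by
  have hls := hφ.isSmooth_of_isFlowIntegral hβ hl
  have hopen := isOpen_extChartAt_target (I := 𝓘(ℝ, E)) x
  have hP := fun w => hφ.contDiffOn_inChart_pullback hβ x w
  -- With `d` outside the pullback, both sides are alternating sums of directional derivatives of
  -- coefficients, and differentiation under the integral applies termwise.
  simp_rw [← Form.d_pullback hβ (hφ.contMDiff _) (hφ.isSmooth_pullback hβ _),
    Form.inChart_d hls hy, Form.inChart_d (hφ.isSmooth_pullback hβ _) hy,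
    extDeriv_apply ((hls.contDiffAt hy).differentiableAt (by simp)),
    extDeriv_apply (((hφ.isSmooth_pullback hβ _).contDiffAt hy).differentiableAt (by simp))]
  have hslice : ∀ (w : Fin k → E) (u : E) (τ : ℝ),
      fderiv ℝ (fun z => (β.pullback (φ τ)).inChart x z w) y u =
        fderiv ℝ (fun p : ℝ × E => (β.pullback (φ p.1)).inChart x p.2 w) (τ, y) (0, u) :=
    fun w u τ => congrArg (fun L : E →L[ℝ] ℝ => L u) (hasFDerivAt_comp_prodMk_right
      (((hP w).contDiffAt ((isOpen_univ.prod hopen).mem_nhds ⟨mem_univ τ, hy⟩)).differentiableAt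
        (by simp))).fderiv
  have hcont : ∀ (w : Fin k → E) (u : E), Continuous fun τ =>
      fderiv ℝ (fun p : ℝ × E => (β.pullback (φ p.1)).inChart x p.2 w) (τ, y) (0, u) := by
    intro w u
    refine Continuous.clm_apply ?_ continuous_const
    exact ((hP w).continuousOn_fderiv_of_isOpen (isOpen_univ.prod hopen)
      (by simp)).comp_continuous (f := fun τ : ℝ => (τ, y)) (by fun_prop)
      fun τ => ⟨mem_univ _, hy⟩
  simp_rw [hslice, ← Int.cast_smul_eq_zsmul ℝ]
  have hint : ∀ i ∈ (Finset.univ : Finset (Fin (k + 1))), IntervalIntegrable (fun τ =>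
      (((-1) ^ i.val : ℤ) : ℝ) • fderiv ℝ (fun p : ℝ × E => (β.pullback (φ p.1)).inChart x p.2
        (i.removeNth v)) (τ, y) (0, v i)) volume 0 t := fun i _ =>
    (Continuous.fun_const_smul (hcont _ _) _).intervalIntegrable _ _
  rw [intervalIntegral.integral_finsetSum hint]
  refine Finset.sum_congr rfl fun i _ => ?_
  rw [intervalIntegral.integral_smul]
  congr 1
  rw [← fderiv_intervalIntegral_apply hopen (by simp) (hP _) t hy]
  congr 2
  funext z
  exact hl _ _

/-- The exterior derivative commutes with the integration along the flow. -/
theorem IsCompleteFlow.isFlowIntegral_d [FiniteDimensional ℝ E]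
    (hφ : IsCompleteFlow X φ) {k : ℕ} {β l : Form E M k} (hβ : β.IsSmooth) {t : ℝ}
    (hl : Form.IsFlowIntegral φ β t l) : Form.IsFlowIntegral φ β.d t l.d := by
  intro x v
  simp_rw [Form.apply_eq_inChart _ x v]
  exact hφ.inChart_d_of_isFlowIntegral hβ hl (mem_extChartAt_target x) _

/-- The interior product with the velocity field of the flow, in coordinates. -/
theorem IsCompleteFlow.inChart_interior (hφ : IsCompleteFlow X φ) {k : ℕ} (θ : Form E M (k + 1))
    {x₀ : M} {y : E} (hy : y ∈ (extChartAt 𝓘(ℝ, E) x₀).target) :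
    (θ.interior X).inChart x₀ y = ContinuousAlternatingMap.curryLeft (θ.inChart x₀ y)
      (fderiv ℝ (fun p : ℝ × E =>
        extChartAt 𝓘(ℝ, E) x₀ (φ p.1 ((extChartAt 𝓘(ℝ, E) x₀).symm p.2))) (0, y) (1, 0)) := by
  set e := extChartAt 𝓘(ℝ, E) x₀
  set G : ℝ × E → E := fun p => e (φ p.1 (e.symm p.2))
  have hφy : φ 0 (e.symm y) ∈ e.source := by
    rw [hφ.map_zero]
    exact e.map_target hy
  have hG : DifferentiableAt ℝ G (0, y) :=
    (hφ.contDiffAt_inChart hy hφy).differentiableAt (by simp)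
  have hG₀ : G (0, y) = y := by
    change e (φ 0 (e.symm y)) = y
    rw [hφ.map_zero, e.right_inv hy]
  have h1 : HasFDerivAt (fun t => G (t, y))
      ((fderiv ℝ G (0, y)).comp (ContinuousLinearMap.inl ℝ ℝ E)) (0 : ℝ) :=
    HasFDerivAt.comp (g := G) (f := fun t : ℝ => (t, y)) (0 : ℝ) hG.hasFDerivAt
      (hasFDerivAt_prodMk_left (0 : ℝ) y)
  have h2 : HasMFDerivAt 𝓘(ℝ, E) 𝓘(ℝ, E) e.symm (G (0, y))
      (mfderiv 𝓘(ℝ, E) 𝓘(ℝ, E) e.symm y : E →L[ℝ] E) := by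
    rw [hG₀]
    exact (mdifferentiableAt_extChartAt_symm hy).hasMFDerivAt
  have h3 := HasMFDerivAt.comp (0 : ℝ) h2 h1.hasMFDerivAt
  have h4 := hφ.isMIntegralCurve (e.symm y) 0
  have hev : (fun t => φ t (e.symm y)) =ᶠ[𝓝 0] e.symm ∘ fun t => G (t, y) := by
    filter_upwards [h4.continuousAt.preimage_mem_nhds
      ((isOpen_extChartAt_source x₀).mem_nhds hφy)] with t ht
    exact (e.left_inv ht).symm
  -- The orbit has two derivatives at time `0`: the value of `X`, and the image under the inverse
  -- chart of the coordinate velocity.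
  have h5 := hasMFDerivAt_unique h4 (h3.congr_of_eventuallyEq hev)
  have h6 : (X (φ 0 (e.symm y)) : E) = (mfderiv 𝓘(ℝ, E) 𝓘(ℝ, E) e.symm y : E →L[ℝ] E)
      (fderiv ℝ G (0, y) (1, 0)) := by
    have := congrArg (fun L : ℝ →L[ℝ] E => L 1) h5
    refine Eq.trans ?_ this
    exact (one_smul ℝ (X (φ 0 (e.symm y)) : E)).symm
  have h7 : (X (φ 0 (e.symm y)) : E) = (X (e.symm y) : E) := by rw [hφ.map_zero]
  ext w
  refine θ.apply_congr rfl (funext fun i => ?_)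
  refine Fin.cases ?_ (fun i => ?_) i
  · exact h7.symm.trans h6
  · rfl

/-- In coordinates, `X` is the time derivative of the jointly smooth flow at time `0`, hence smooth.
-/
theorem IsCompleteFlow.isSmooth_interior [FiniteDimensional ℝ E] (hφ : IsCompleteFlow X φ) {k : ℕ}
    {θ : Form E M (k + 1)} (hθ : θ.IsSmooth) : (θ.interior X).IsSmooth := by
  intro x₀
  refine ContDiffOn.congr ?_ fun y hy => hφ.inChart_interior θ hy
  refine contDiffOn_continuousAlternatingMap_of_apply fun w y hy => ?_
  refine ContDiffAt.contDiffWithinAt ?_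
  have hG := hφ.contDiffAt_inChart (x₁ := x₀) (τ := 0) hy (by
    rw [hφ.map_zero]
    exact PartialEquiv.map_target _ hy)
  have hξ := ContDiffAt.clm_apply (ContDiffAt.comp y (hG.fderiv_right (m := ∞) (by simp))
    (contDiff_const.prodMk contDiff_id).contDiffAt) (contDiffAt_const (c := ((1, 0) : ℝ × E)))
  refine (hθ.contDiffAt hy).continuousAlternatingMap_apply fun i => ?_
  refine Fin.cases ?_ (fun i => ?_) i
  · exact hξ
  · exact contDiffAt_const

/-- Cartan's magic formula for the Lie derivative along the flow. -/
theorem IsCompleteFlow.hasLieDeriv (hφ : IsCompleteFlow X φ) {k : ℕ}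
    {θ : Form E M (k + 1)} (hθ : θ.IsSmooth) (hi : (θ.interior X).IsSmooth) :
    θ.HasLieDeriv φ (θ.d.interior X + (θ.interior X).d) := by
  intro x v
  simp_rw [Form.apply_eq_inChart _ x v]
  have hy := mem_extChartAt_target (I := 𝓘(ℝ, E)) x
  have hφy : φ 0 ((extChartAt 𝓘(ℝ, E) x).symm (extChartAt 𝓘(ℝ, E) x x)) ∈
      (extChartAt 𝓘(ℝ, E) x).source := by
    rw [hφ.map_zero]
    exact PartialEquiv.map_target _ hy
  have htarget := (isOpen_extChartAt_target (I := 𝓘(ℝ, E)) x).mem_nhds hy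
  have key := hasDerivAt_comp_fderiv_of_eventually_eq_id
    ((hθ.contDiffAt hy).differentiableAt (by simp)) (hφ.contDiffAt_inChart hy hφy)
    (by
      filter_upwards [htarget] with z hz
      rw [hφ.map_zero, PartialEquiv.right_inv _ hz])
    (fun i => mfderiv 𝓘(ℝ, E) 𝓘(ℝ, E) (extChartAt 𝓘(ℝ, E) x) x (v i))
  have hev := hφ.eventually_inChart_pullback θ hy hφy
  have hev' := ((Continuous.prodMk_left (extChartAt 𝓘(ℝ, E) x x)).tendsto (0 : ℝ)).eventually hev
  refine (key.congr_of_eventuallyEq (hev'.mono fun t ht =>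
    congrArg (fun a : E [⋀^Fin (k + 1)]→L[ℝ] ℝ => a _) ht)).congr_deriv ?_
  have hadd : (θ.d.interior X + (θ.interior X).d).inChart x (extChartAt 𝓘(ℝ, E) x x) =
    (θ.d.interior X).inChart x (extChartAt 𝓘(ℝ, E) x x) +
      (θ.interior X).d.inChart x (extChartAt 𝓘(ℝ, E) x x) := rfl
  rw [hadd, hφ.inChart_interior _ hy, Form.inChart_d hθ hy, Form.inChart_d hi hy,
    Filter.EventuallyEq.extDeriv_eq
      (Filter.mem_of_superset htarget fun z hz => hφ.inChart_interior θ hz)]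
  rfl

/-- Both directions are the fundamental theorem of calculus for `t ↦ φ_t^*α`, whose derivative is
`φ_t^* dβ`; the converse evaluates the integrand at time `0`, where the pullback is trivial. -/
theorem IsCompleteFlow.hasLieDeriv_iff_generatesFlow [FiniteDimensional ℝ E]
    (hφ : IsCompleteFlow X φ) {k : ℕ} (α : Form E M (k + 1)) {β : Form E M k} (hβ : β.IsSmooth) :
    α.HasLieDeriv φ β.d ↔ Form.GeneratesFlow φ α β := by
  constructor
  · intro h t
    obtain ⟨l, hl⟩ := hφ.exists_isFlowIntegral hβ t
    refine ⟨l, hφ.isSmooth_of_isFlowIntegral hβ hl, hl, ?_⟩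
    funext x
    ext v
    rw [hφ.isFlowIntegral_d hβ hl x v, intervalIntegral.integral_eq_sub_of_hasDerivAt
      (fun s _ => hφ.hasDerivAt_pullback h s x v)
      ((hφ.continuous_pullback_apply hβ.d x v).intervalIntegrable _ _), hφ.pullback_zero]
    rfl
  · intro h x v
    have hc := hφ.continuous_pullback_apply hβ.d x v
    have hft : ∀ t, α.pullback (φ t) x v =
        α x v + ∫ τ in (0 : ℝ)..t, β.d.pullback (φ τ) x v := by
      intro t
      obtain ⟨l, -, hl, hlt⟩ := h t
      rw [← hφ.isFlowIntegral_d hβ hl x v, ← hlt]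
      exact (add_sub_cancel (α x v) (α.pullback (φ t) x v)).symm
    simp_rw [hft]
    have := (hc.integral_hasStrictDerivAt 0 0).hasDerivAt.const_add (α x v)
    rwa [hφ.pullback_zero] at this

end Flow

end ExactFlow

/-- Here `n` is the dimension minus 2, so the bound on the dimension is built into the degrees of
the forms. -/
theorem mainTheorem2
    {E : Type*} [NormedAddCommGroup E] [NormedSpace ℝ E] [FiniteDimensional ℝ E]
    {M : Type*} [TopologicalSpace M] [T2Space M] [ChartedSpace E M] [IsManifold 𝓘(ℝ, E) ∞ M]
    (n : ℕ) (Ω : ExactFlow.Form E M (n + 2)) (hΩ : Ω.IsVolumeForm)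
    (α : ExactFlow.Form E M (n + 1)) (hα : α.IsSmooth) (hΩα : Ω = α.d)
    (X : ∀ x : M, TangentSpace 𝓘(ℝ, E) x)
    (hX : ContMDiff 𝓘(ℝ, E) 𝓘(ℝ, E).tangent ∞ (fun x => (⟨x, X x⟩ : TangentBundle 𝓘(ℝ, E) M)))
    (φ : ℝ → M → M) (hφ : ExactFlow.IsCompleteFlow X φ) :
    List.TFAE [
      (Ω.interior X).IsExact,
      ∃ β : ExactFlow.Form E M n, β.IsSmooth ∧ α.HasLieDeriv φ β.d,
      ∃ β : ExactFlow.Form E M n, β.IsSmooth ∧ ExactFlow.Form.GeneratesFlow φ α β] ∧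
    ∀ β : ExactFlow.Form E M n, β.IsSmooth →
      (α.HasLieDeriv φ β.d ↔ ExactFlow.Form.GeneratesFlow φ α β) := by

  have hiff : ∀ β : ExactFlow.Form E M n, β.IsSmooth →
      (α.HasLieDeriv φ β.d ↔ ExactFlow.Form.GeneratesFlow φ α β) :=
    fun β hβ => hφ.hasLieDeriv_iff_generatesFlow α hβ
  refine ⟨?_, hiff⟩
  have hi : (α.interior X).IsSmooth := hφ.isSmooth_interior hα
  have hcartan := hφ.hasLieDeriv hα hi
  rw [← hΩα] at hcartan
  tfae_have 1 → 2 := by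
    rintro ⟨η, hη, hdη⟩
    -- By Cartan's formula, adding `i_X α` turns a primitive of `i_X Ω` into one of `L_X α`.
    refine ⟨η + α.interior X, hη.add hi, ?_⟩
    rw [ExactFlow.Form.d_add hη hi, hdη]
    exact hcartan
  tfae_have 2 → 1 := by
    rintro ⟨β, hβ, hd⟩
    have hβd : β.d = Ω.interior X + (α.interior X).d := hd.unique hcartan
    refine ⟨β - α.interior X, hβ.sub hi, ?_⟩
    -- Additivity of `d` on `β = (β - i_X α) + i_X α`; cancelling `d(i_X α)` leaves `i_X Ω`.
    have hadd := ExactFlow.Form.d_add (hβ.sub hi) hi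
    rw [sub_add_cancel, hβd] at hadd
    exact (add_right_cancel hadd).symm
  tfae_have 2 ↔ 3 := by
    constructor
    · rintro ⟨β, hβ, h⟩
      exact ⟨β, hβ, (hiff β hβ).1 h⟩
    · rintro ⟨β, hβ, h⟩
      exact ⟨β, hβ, (hiff β hβ).2 h⟩
  tfae_finish
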